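/- Let $W=(W_t)_{t\ge0}$ be a standard Brownian motion on a probability space, let $\sigma,\gamma,\kappa,\varepsilon,T>0$ and $c\in\mathbb R$, and set $$\beta=\frac{\gamma^2}{2\kappa\sigma^2},\qquad G_\varepsilon(x)=\frac1{\sqrt{2\pi\varepsilon}}\,e^{-(x-c)^2/(2\varepsilon)},\quad x\in\mathbb R.$$ Then for all $t\ge0$ and $z\in\mathbb R$ the random variable $e^{\beta\int_0^tG_\varepsilon(z+\sigma W_r)\,dr}$ is integrable, and the function $$U^\varepsilon(t,z)=\frac1\beta\log E\Big[e^{\beta\int_0^tG_\varepsilon(z+\sigma W_r)\,dr}\Big]$$ belongs to $C^{1,2}([0,\infty)\times\mathbb R)$, that is, $U^\varepsilon$ is continuous and the derivatives $\partial_tU^\varepsilon$, $\partial_zU^\varepsilon$, $\partial_{zz}U^\varepsilon$ exist and are jointly continuous on $[0,\infty)\times\mathbb R$ (with a one-sided time derivative at $t=0$). Moreover, its restriction $U$ to $[0,T]\times[c,\infty)$ is a classical solution of the Hamilton–Jacobi–Bellman problem $$\partial_tU=\frac{\sigma^2}2\partial_{zz}U+G_\varepsilon+\sup_{v\in\mathbb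 R}\big(\gamma v\,\partial_zU-\kappa v^2\big)\qquad\text{in }(0,T]\times(c,\infty),$$ $$U(0,z)=0\ \text{ for all } z\ge c,\qquad \partial_zU(t,c)=0\ \text{ for all } 0\le t\le T;$$ that is, $U\in C^{1,2}([0,T]\times[c,\infty))$ (with one-sided derivatives at the boundary), the supremum is finite, and the equation, the initial condition and the boundary condition hold pointwise. -/

import Mathlib

open MeasureTheory ProbabilityTheory
open scoped NNReal

/-- The time derivative of `U` at `(t, z)`, taken within the time interval `I`
(hence one-sided at an endpoint that belongs to `I`). -/
noncomputable def dt (I : Set ℝ) (U : ℝ → ℝ → ℝ) (t z : ℝ) : ℝ :=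
  derivWithin (fun s => U s z) I t

/-- The space derivative of `U` at `(t, z)`, taken within the space interval `J`
(hence one-sided at an endpoint that belongs to `J`). -/
noncomputable def dz (J : Set ℝ) (U : ℝ → ℝ → ℝ) (t z : ℝ) : ℝ :=
  derivWithin (fun y => U t y) J z

/-- The second space derivative of `U` at `(t, z)`, taken within the space interval `J`. -/
noncomputable def dzz (J : Set ℝ) (U : ℝ → ℝ → ℝ) (t z : ℝ) : ℝ :=
  derivWithin (fun y => dz J U t y) J z

/-- `U` belongs to `C^{1,2}(I × J)`: on `I × J` the derivatives `∂_t U`, `∂_z U`, `∂_zz U` exist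
(one-sided at the boundary), and `U` and these derivatives are jointly continuous.
Only the values of `U` on `I × J` matter. -/
structure IsC12On (I J : Set ℝ) (U : ℝ → ℝ → ℝ) : Prop where
  continuousOn : ContinuousOn (fun p : ℝ × ℝ => U p.1 p.2) (I ×ˢ J)
  differentiable_t : ∀ t ∈ I, ∀ z ∈ J, DifferentiableWithinAt ℝ (fun s => U s z) I t
  differentiable_z : ∀ t ∈ I, ∀ z ∈ J, DifferentiableWithinAt ℝ (fun y => U t y) J z
  differentiable_zz : ∀ t ∈ I, ∀ z ∈ J, DifferentiableWithinAt ℝ (fun y => dz J U t y) J z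
  continuousOn_dt : ContinuousOn (fun p : ℝ × ℝ => dt I U p.1 p.2) (I ×ˢ J)
  continuousOn_dz : ContinuousOn (fun p : ℝ × ℝ => dz J U p.1 p.2) (I ×ˢ J)
  continuousOn_dzz : ContinuousOn (fun p : ℝ × ℝ => dzz J U p.1 p.2) (I ×ˢ J)

/-- The Gaussian kernel `G_ε(x) = (2πε)^{-1/2} exp(-(x - c)² / (2ε))`. -/
noncomputable def gaussKernel (c ε x : ℝ) : ℝ :=
  1 / √(2 * Real.pi * ε) * Real.exp (-(x - c) ^ 2 / (2 * ε))

/-- The random variable `exp (β ∫_0^t G_ε(z + σ W_r) dr)`. -/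
noncomputable def expFunctional {Ω : Type*} (W : ℝ≥0 → Ω → ℝ) (σ c ε β t z : ℝ) (ω : Ω) : ℝ :=
  Real.exp (β * ∫ r in (0 : ℝ)..t, gaussKernel c ε (z + σ * W r.toNNReal ω))

/-- `U^ε(t, z) = (1/β) log E[exp (β ∫_0^t G_ε(z + σ W_r) dr)]`. -/
noncomputable def approxValue {Ω : Type*} [MeasurableSpace Ω] (P : Measure Ω)
    (W : ℝ≥0 → Ω → ℝ) (σ c ε β t z : ℝ) : ℝ :=
  1 / β * Real.log (∫ ω, expFunctional W σ c ε β t z ω ∂P)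

/-- `U`, restricted to `[0,T] × [c,∞)`, is a classical solution of the Hamilton--Jacobi--Bellman
equation `∂_t U = (σ²/2) ∂_zz U + G_ε + sup_v (γ v ∂_z U - κ v²)` in `(0,T] × (c,∞)` with initial
condition `U(0, ·) = 0` on `[c,∞)` and Neumann condition `∂_z U(t, c) = 0` for `t ∈ [0,T]`.
That the supremum is finite is part of the definition. All derivatives are derivatives of the
restriction to `[0,T] × [c,∞)`. -/
structure IsClassicalHJBSolution (σ γ κ c ε T : ℝ) (U : ℝ → ℝ → ℝ) : Prop where
  regular : IsC12On (Set.Icc 0 T) (Set.Ici c) U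
  bddAbove : ∀ t ∈ Set.Ioc 0 T, ∀ z ∈ Set.Ioi c,
    BddAbove (Set.range fun v : ℝ => γ * v * dz (Set.Ici c) U t z - κ * v ^ 2)
  equation : ∀ t ∈ Set.Ioc 0 T, ∀ z ∈ Set.Ioi c,
    dt (Set.Icc 0 T) U t z =
      σ ^ 2 / 2 * dzz (Set.Ici c) U t z + gaussKernel c ε z
        + ⨆ v : ℝ, (γ * v * dz (Set.Ici c) U t z - κ * v ^ 2)
  initial : ∀ z ∈ Set.Ici c, U 0 z = 0
  neumann : ∀ t ∈ Set.Icc 0 T, dz (Set.Ici c) U t c = 0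

/-! The proof is the Cole–Hopf transform followed by a direct proof of the Feynman–Kac equation. Put
`φ = β G_ε`, `A_t = ∫_0^t φ(z + σ W_r) dr` and `V = E[exp A_t]`, so that `U = (1/β) log V`. The
supremum over `v` equals `γ² (∂_z U)² / (4κ)`, and the value of `β` makes this `(β σ²/2) (∂_z U)²`.
It cancels the quadratic term in the second derivative of `log V`, so the HJB equation reduces to
the linear equation `∂_t V = (σ²/2) ∂_zz V + φ V`.

Regularity needs neither parabolic theory nor Itô calculus: `φ`, `φ'`, `φ''` are bounded, so `V` may
be differentiated under the expectation. For the equation, the Markov property `V(s+t, z) =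
E[exp(A_s) V(t, z + σ W_s)]` (`feynmanKac_add`) splits the time increment of `V` in two. The
Gaussian average of `V(t, ·)` gives the second-order term by Taylor expansion (`tendsto_generator`),
and the factor `exp(A_s) - 1` gives `φ V` (`tendsto_integral_slope_exp_mul`).

Statements on the law of the path, namely the Markov property and invariance under `W ↦ -W`, hold
for Riemann sums by finite-dimensional distributions and independence of increments, and pass to the
limit by dominated convergence. The Neumann condition holds because `G_ε` is symmetric about `c`,
which with the symmetry of `W` makes `V(t, ·)` even about `c`. -/

open Filter Topology

/-! ### Convergence of Riemann sums -/

/-- The left Riemann sum of `f` over `[0, t]` with `n` equal steps. -/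
noncomputable def leftRiemannSum (f : ℝ → ℝ) (t : ℝ) (n : ℕ) : ℝ :=
  t / n * ∑ k ∈ Finset.range n, f (k * t / n)

/-- Uniform continuity on `[0, 1]`: once `1/n < δ`, each of the `n` cells contributes an error of at
most `(ε/2)/n`. -/
theorem tendsto_leftRiemannSum_one {f : ℝ → ℝ} (hf : Continuous f) :
    Tendsto (leftRiemannSum f 1) atTop (𝓝 (∫ x in (0 : ℝ)..1, f x)) := by
  rw [Metric.tendsto_atTop]
  intro ε hε
  have huc : UniformContinuousOn f (Set.Icc 0 1) :=
    isCompact_Icc.uniformContinuousOn_of_continuous hf.continuousOn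
  obtain ⟨δ, hδ, h⟩ := Metric.uniformContinuousOn_iff.1 huc (ε / 2) (by positivity)
  obtain ⟨N, hN⟩ := exists_nat_gt (1 / δ)
  refine ⟨N + 1, fun n hn => ?_⟩
  have hn0 : (0 : ℝ) < n := by exact_mod_cast (by omega : 0 < n)
  have hnδ : 1 / (n : ℝ) < δ := by
    rw [div_lt_comm₀ hn0 hδ]
    exact hN.trans (by exact_mod_cast (by omega : N < n))
  have hsum : ∫ x in (0 : ℝ)..1, f x
      = ∑ k ∈ Finset.range n, ∫ x in ((k : ℕ) / n : ℝ)..((k + 1 : ℕ) / n : ℝ), f x := by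
    have := intervalIntegral.sum_integral_adjacent_intervals (μ := volume) (f := f)
      (a := fun k : ℕ => (k : ℝ) / n) (n := n) fun k _ => hf.intervalIntegrable _ _
    rw [this]
    simp [hn0.ne']
  have hrs : leftRiemannSum f 1 n
      = ∑ k ∈ Finset.range n, ∫ x in ((k : ℕ) / n : ℝ)..((k + 1 : ℕ) / n : ℝ), f (k / n) := by
    unfold leftRiemannSum
    rw [Finset.mul_sum]
    refine Finset.sum_congr rfl fun k _ => ?_
    simp only [intervalIntegral.integral_const, smul_eq_mul, mul_one]
    push_cast
    ring
  rw [hsum, hrs, dist_eq_norm, ← Finset.sum_sub_distrib]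
  have hk : ∀ k ∈ Finset.range n,
      ‖(∫ x in ((k : ℕ) / n : ℝ)..((k + 1 : ℕ) / n : ℝ), f (k / n))
        - ∫ x in ((k : ℕ) / n : ℝ)..((k + 1 : ℕ) / n : ℝ), f x‖ ≤ ε / 2 * (1 / n) := by
    intro k hk
    have hk' : (k : ℝ) + 1 ≤ n := by exact_mod_cast Finset.mem_range.1 hk
    have hle : (k / n : ℝ) ≤ ((k + 1 : ℕ) / n : ℝ) := by gcongr; simp
    have hstep : ((k + 1 : ℕ) / n : ℝ) - k / n = 1 / n := by push_cast; ring
    have h1 : ((k + 1 : ℕ) / n : ℝ) ≤ 1 := by rw [div_le_one hn0]; exact_mod_cast hk'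
    have h0 : (0 : ℝ) ≤ k / n := by positivity
    rw [← intervalIntegral.integral_sub (by simp) (hf.intervalIntegrable _ _)]
    refine (intervalIntegral.norm_integral_le_of_norm_le_const (C := ε / 2) fun x hx => ?_).trans ?_
    · rw [Set.uIoc_of_le hle] at hx
      rw [← dist_eq_norm]
      refine (h _ ⟨h0, hle.trans h1⟩ _ ⟨h0.trans hx.1.le, hx.2.trans h1⟩ ?_).le
      rw [dist_comm, Real.dist_eq, abs_of_nonneg (by linarith [hx.1])]
      linarith [hx.2]
    · rw [hstep, abs_of_pos (by positivity)]
  refine (norm_sum_le_of_le _ hk).trans_lt ?_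
  simp only [Finset.sum_const, Finset.card_range, nsmul_eq_mul]
  field_simp
  linarith

theorem tendsto_leftRiemannSum {f : ℝ → ℝ} (hf : Continuous f) (t : ℝ) :
    Tendsto (leftRiemannSum f t) atTop (𝓝 (∫ x in (0 : ℝ)..t, f x)) := by
  have h := (tendsto_leftRiemannSum_one (f := fun s => f (t * s)) (by fun_prop)).const_mul t
  have e1 : t * ∫ s in (0 : ℝ)..1, f (t * s) = ∫ x in (0 : ℝ)..t, f x := by simp
  rw [e1] at h
  refine h.congr fun n => ?_
  unfold leftRiemannSum
  rw [← mul_assoc]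
  congr 1
  · ring
  · refine Finset.sum_congr rfl fun k _ => congrArg f ?_
    ring

/-! ### Continuity and differentiation under the expectation -/

section ParametricExpectation

variable {Ω : Type*} [MeasurableSpace Ω] {P : Measure Ω} [IsFiniteMeasure P]

/-- The bound `B` may grow with `x`, as `exp (M |t|)` does. By continuity the constant `B x₀ + 1`
dominates near `x₀`, and constants are integrable for a finite measure. -/
theorem continuous_integral_of_continuous_bound {X : Type*} [TopologicalSpace X]
    [FirstCountableTopology X] {F : X → Ω → ℝ} {B : X → ℝ}
    (hm : ∀ x, AEStronglyMeasurable (F x) P) (hB : Continuous B) (hb : ∀ x ω, |F x ω| ≤ B x)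
    (hc : ∀ ω, Continuous fun x => F x ω) : Continuous fun x => ∫ ω, F x ω ∂P := by
  rw [continuous_iff_continuousAt]
  intro x₀
  refine continuousAt_of_dominated (bound := fun _ => B x₀ + 1) (.of_forall hm) ?_
    (integrable_const _) (.of_forall fun ω => (hc ω).continuousAt)
  filter_upwards [hB.continuousAt.eventually (gt_mem_nhds (lt_add_one (B x₀)))] with x hx
  exact .of_forall fun ω => (hb x ω).trans hx.le

theorem hasDerivAt_integral_of_continuous_bound {F F' : ℝ → Ω → ℝ} {B B' : ℝ → ℝ}
    (hm : ∀ x, AEStronglyMeasurable (F x) P) (hm' : ∀ x, AEStronglyMeasurable (F' x) P)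
    (hb : ∀ x ω, |F x ω| ≤ B x) (hB' : Continuous B') (hb' : ∀ x ω, |F' x ω| ≤ B' x)
    (hd : ∀ x ω, HasDerivAt (fun y => F y ω) (F' x ω) x) (x₀ : ℝ) :
    HasDerivAt (fun x => ∫ ω, F x ω ∂P) (∫ ω, F' x₀ ω ∂P) x₀ := by
  refine (hasDerivAt_integral_of_dominated_loc_of_deriv_le (μ := P) (bound := fun _ => B' x₀ + 1)
    (hB'.continuousAt.eventually (gt_mem_nhds (lt_add_one (B' x₀)))) (.of_forall hm)
    (Integrable.of_bound (hm x₀) (B x₀) (.of_forall fun ω => hb x₀ ω)) (hm' x₀) ?_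
    (integrable_const _) (.of_forall fun ω x _ => hd x ω)).2
  exact .of_forall fun ω x hx => (hb' x ω).trans (le_of_lt hx)

end ParametricExpectation

/-! ### The additive functional along a continuous path -/

section PathIntegral

variable {Ω : Type*} {W : ℝ≥0 → Ω → ℝ} {σ : ℝ} {ψ : ℝ → ℝ}

/-- The additive functional `∫_0^t ψ(z + σ W_r) dr`. -/
noncomputable def pathIntegral (W : ℝ≥0 → Ω → ℝ) (σ : ℝ) (ψ : ℝ → ℝ) (t z : ℝ) (ω : Ω) : ℝ :=
  ∫ r in (0 : ℝ)..t, ψ (z + σ * W r.toNNReal ω)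

theorem abs_pathIntegral_le {M : ℝ} (hM : ∀ x, |ψ x| ≤ M) (t z : ℝ) (ω : Ω) :
    |pathIntegral W σ ψ t z ω| ≤ M * |t| := by
  simpa [pathIntegral] using intervalIntegral.norm_integral_le_of_norm_le_const (a := 0) (b := t) (C := M)
    (f := fun r => ψ (z + σ * W r.toNNReal ω)) fun x _ => hM _

theorem continuous_pathIntegral (hψ : Continuous ψ) {ω : Ω} (hW : Continuous (W · ω)) :
    Continuous fun p : ℝ × ℝ => pathIntegral W σ ψ p.1 p.2 ω := by
  have hW' : Continuous fun r : ℝ => W r.toNNReal ω := hW.comp continuous_real_toNNReal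
  refine intervalIntegral.continuous_parametric_intervalIntegral_of_continuous
    (f := fun (p : ℝ × ℝ) r => ψ (p.2 + σ * W r.toNNReal ω)) ?_ continuous_fst
  have := hW'.comp (continuous_snd : Continuous (Prod.snd : (ℝ × ℝ) × ℝ → ℝ))
  exact hψ.comp (continuous_fst.snd.add (continuous_const.mul this))

/-- Valid for every real `t`: `toNNReal` freezes the path at `W 0` for negative times, so the
integrand is continuous on the whole line and the derivative at `0` is two-sided. -/
theorem hasDerivAt_pathIntegral_time (hψ : Continuous ψ) {ω : Ω} (hW : Continuous (W · ω))
    (t z : ℝ) :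
    HasDerivAt (fun s => pathIntegral W σ ψ s z ω) (ψ (z + σ * W t.toNNReal ω)) t := by
  have hW' : Continuous fun r : ℝ => W r.toNNReal ω := hW.comp continuous_real_toNNReal
  have hc : Continuous fun r : ℝ => ψ (z + σ * W r.toNNReal ω) := by fun_prop
  exact (hc.integral_hasStrictDerivAt 0 t).hasDerivAt

theorem hasDerivAt_pathIntegral_space {ψ' : ℝ → ℝ} (hd : ∀ x, HasDerivAt ψ (ψ' x) x)
    (hψ' : Continuous ψ') {M : ℝ} (hM : ∀ x, |ψ' x| ≤ M) {ω : Ω} (hW : Continuous (W · ω))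
    (t z : ℝ) :
    HasDerivAt (fun y => pathIntegral W σ ψ t y ω) (pathIntegral W σ ψ' t z ω) z := by
  have hW' : Continuous fun r : ℝ => W r.toNNReal ω := hW.comp continuous_real_toNNReal
  have hψ : Continuous ψ := continuous_iff_continuousAt.2 fun x => (hd x).continuousAt
  have hc (y : ℝ) : Continuous fun r : ℝ => ψ (y + σ * W r.toNNReal ω) := by fun_prop
  have hc' : Continuous fun r : ℝ => ψ' (z + σ * W r.toNNReal ω) := by fun_prop
  refine (intervalIntegral.hasDerivAt_integral_of_dominated_loc_of_deriv_le (s := Set.univ)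
    (F := fun y r => ψ (y + σ * W r.toNNReal ω)) (F' := fun y r => ψ' (y + σ * W r.toNNReal ω))
    (bound := fun _ => M) univ_mem (.of_forall fun y => (hc y).aestronglyMeasurable)
    ((hc z).intervalIntegrable _ _) hc'.aestronglyMeasurable
    (.of_forall fun r _ y _ => hM _) (by simp) (.of_forall fun r _ y _ => ?_)).2
  exact (hd _).comp_add_const y _

/-- Pathwise half of the Markov property: after time `h` the functional is that of the restarted
path `W (h + r) - W h`, with starting point `z + σ W h`. -/
theorem pathIntegral_add (hψ : Continuous ψ) {ω : Ω} (hW : Continuous (W · ω))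
    (h t : ℝ≥0) (z : ℝ) :
    pathIntegral W σ ψ (h + t) z ω = pathIntegral W σ ψ h z ω
      + pathIntegral (fun r ω => W (h + r) ω - W h ω) σ ψ t (z + σ * W h ω) ω := by
  have hW' : Continuous fun r : ℝ => W r.toNNReal ω := hW.comp continuous_real_toNNReal
  have hc : Continuous fun r : ℝ => ψ (z + σ * W r.toNNReal ω) := by fun_prop
  unfold pathIntegral
  rw [← intervalIntegral.integral_add_adjacent_intervals (hc.intervalIntegrable 0 h)
    (hc.intervalIntegrable h _)]
  congr 1
  have := intervalIntegral.integral_comp_add_left (a := 0) (b := t)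
    (fun r : ℝ => ψ (z + σ * W r.toNNReal ω)) (h : ℝ)
  rw [add_zero] at this
  rw [← this]
  refine intervalIntegral.integral_congr fun r hr => ?_
  rw [Set.uIcc_of_le t.coe_nonneg] at hr
  have : ((h : ℝ) + r).toNNReal = h + r.toNNReal := by
    rw [Real.toNNReal_add h.coe_nonneg hr.1, Real.toNNReal_coe]
  simp only [this]
  congr 1
  ring

theorem tendsto_leftRiemannSum_path (hψ : Continuous ψ) {ω : Ω} (hW : Continuous (W · ω))
    (t z : ℝ) :
    Tendsto (leftRiemannSum (fun r => ψ (z + σ * W r.toNNReal ω)) t) atTop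
      (𝓝 (pathIntegral W σ ψ t z ω)) := by
  have hW' : Continuous fun r : ℝ => W r.toNNReal ω := hW.comp continuous_real_toNNReal
  exact tendsto_leftRiemannSum (by fun_prop) t

theorem aemeasurable_leftRiemannSum_path [MeasurableSpace Ω] {P : Measure Ω}
    (hψ : Continuous ψ) (hm : ∀ t, AEMeasurable (W t) P) (t z : ℝ) (n : ℕ) :
    AEMeasurable (fun ω => leftRiemannSum (fun r => ψ (z + σ * W r.toNNReal ω)) t n) P := by
  unfold leftRiemannSum
  refine AEMeasurable.const_mul (Finset.aemeasurable_fun_sum _ fun k _ => ?_) _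
  exact hψ.measurable.comp_aemeasurable (((hm _).const_mul σ).const_add z)

/-- A pointwise limit of Riemann sums, so measurability of each `W t` suffices and no joint
measurability in time and `ω` enters. -/
theorem aemeasurable_pathIntegral [MeasurableSpace Ω] {P : Measure Ω}
    (hψ : Continuous ψ) (hm : ∀ t, AEMeasurable (W t) P) (hW : ∀ ω, Continuous (W · ω))
    (t z : ℝ) : AEMeasurable (pathIntegral W σ ψ t z) P :=
  aemeasurable_of_tendsto_metrizable_ae' (aemeasurable_leftRiemannSum_path hψ hm t z)
    (.of_forall fun ω => tendsto_leftRiemannSum_path hψ (hW ω) t z)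

end PathIntegral

/-! ### Bounded potentials of class C² -/

/-- `φ` is twice continuously differentiable with derivatives `φ'`, `φ''`, all bounded by `M`. -/
structure IsBoundedC2 (φ φ' φ'' : ℝ → ℝ) (M : ℝ) : Prop where
  hasDerivAt : ∀ x, HasDerivAt φ (φ' x) x
  hasDerivAt' : ∀ x, HasDerivAt φ' (φ'' x) x
  continuous'' : Continuous φ''
  bound : ∀ x, |φ x| ≤ M
  bound' : ∀ x, |φ' x| ≤ M
  bound'' : ∀ x, |φ'' x| ≤ M

namespace IsBoundedC2

variable {φ φ' φ'' : ℝ → ℝ} {M : ℝ}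

theorem continuous (h : IsBoundedC2 φ φ' φ'' M) : Continuous φ :=
  continuous_iff_continuousAt.2 fun x => (h.hasDerivAt x).continuousAt

theorem continuous' (h : IsBoundedC2 φ φ' φ'' M) : Continuous φ' :=
  continuous_iff_continuousAt.2 fun x => (h.hasDerivAt' x).continuousAt

theorem nonneg (h : IsBoundedC2 φ φ' φ'' M) : 0 ≤ M := (abs_nonneg _).trans (h.bound 0)

end IsBoundedC2

/-! ### The Feynman–Kac functional and its derivatives -/

section FeynmanKac

variable {Ω : Type*} [MeasurableSpace Ω]

/-- The Feynman--Kac functional `E[exp (∫_0^t φ(z + σ W_r) dr)]`. -/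
noncomputable def feynmanKac (P : Measure Ω) (W : ℝ≥0 → Ω → ℝ) (σ : ℝ) (φ : ℝ → ℝ) (t z : ℝ) : ℝ :=
  ∫ ω, Real.exp (pathIntegral W σ φ t z ω) ∂P

/-- The time derivative of `feynmanKac`. -/
noncomputable def feynmanKacTime (P : Measure Ω) (W : ℝ≥0 → Ω → ℝ) (σ : ℝ) (φ : ℝ → ℝ)
    (t z : ℝ) : ℝ :=
  ∫ ω, Real.exp (pathIntegral W σ φ t z ω) * φ (z + σ * W t.toNNReal ω) ∂P

/-- The space derivative of `feynmanKac`, where `φ'` is the derivative of `φ`. -/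
noncomputable def feynmanKacSpace (P : Measure Ω) (W : ℝ≥0 → Ω → ℝ) (σ : ℝ) (φ φ' : ℝ → ℝ)
    (t z : ℝ) : ℝ :=
  ∫ ω, Real.exp (pathIntegral W σ φ t z ω) * pathIntegral W σ φ' t z ω ∂P

/-- The second space derivative of `feynmanKac`, where `φ'` and `φ''` are the derivatives of `φ`. -/
noncomputable def feynmanKacSpace2 (P : Measure Ω) (W : ℝ≥0 → Ω → ℝ) (σ : ℝ) (φ φ' φ'' : ℝ → ℝ)
    (t z : ℝ) : ℝ :=
  ∫ ω, Real.exp (pathIntegral W σ φ t z ω)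
    * (pathIntegral W σ φ' t z ω ^ 2 + pathIntegral W σ φ'' t z ω) ∂P

variable {P : Measure Ω} {W : ℝ≥0 → Ω → ℝ} {σ M : ℝ} {φ φ' φ'' : ℝ → ℝ}

omit [MeasurableSpace Ω] in
theorem exp_pathIntegral_le (hM : ∀ x, |φ x| ≤ M) (t z : ℝ) (ω : Ω) :
    Real.exp (pathIntegral W σ φ t z ω) ≤ Real.exp (M * |t|) :=
  Real.exp_le_exp.2 ((le_abs_self _).trans (abs_pathIntegral_le hM t z ω))

omit [MeasurableSpace Ω] in
theorem abs_exp_pathIntegral_mul_le (hM : ∀ x, |φ x| ≤ M) (t z : ℝ) (ω : Ω) {a b : ℝ}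
    (hab : |a| ≤ b) :
    |Real.exp (pathIntegral W σ φ t z ω) * a| ≤ Real.exp (M * |t|) * b := by
  rw [abs_mul, Real.abs_exp]
  exact mul_le_mul (exp_pathIntegral_le hM t z ω) hab (abs_nonneg _) (Real.exp_pos _).le

omit [MeasurableSpace Ω] in
theorem abs_pathIntegral_sq_add_le (h : IsBoundedC2 φ φ' φ'' M) (t z : ℝ) (ω : Ω) :
    |pathIntegral W σ φ' t z ω ^ 2 + pathIntegral W σ φ'' t z ω| ≤ (M * |t|) ^ 2 + M * |t| := by
  refine (abs_add_le _ _).trans (add_le_add ?_ (abs_pathIntegral_le h.bound'' t z ω))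
  rw [abs_pow]
  exact pow_le_pow_left₀ (abs_nonneg _) (abs_pathIntegral_le h.bound' t z ω) 2

section Measurability

variable (h : IsBoundedC2 φ φ' φ'' M) (hm : ∀ t, AEMeasurable (W t) P)
  (hW : ∀ ω, Continuous (W · ω))

include h hm hW

theorem aestronglyMeasurable_exp_pathIntegral (t z : ℝ) :
    AEStronglyMeasurable (fun ω => Real.exp (pathIntegral W σ φ t z ω)) P :=
  (aemeasurable_pathIntegral h.continuous hm hW t z).exp.aestronglyMeasurable

theorem aestronglyMeasurable_feynmanKacTime (t z : ℝ) :
    AEStronglyMeasurable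
      (fun ω => Real.exp (pathIntegral W σ φ t z ω) * φ (z + σ * W t.toNNReal ω)) P :=
  (aestronglyMeasurable_exp_pathIntegral h hm hW t z).mul
    (h.continuous.measurable.comp_aemeasurable
      (((hm _).const_mul σ).const_add z)).aestronglyMeasurable

theorem aestronglyMeasurable_feynmanKacSpace (t z : ℝ) :
    AEStronglyMeasurable
      (fun ω => Real.exp (pathIntegral W σ φ t z ω) * pathIntegral W σ φ' t z ω) P :=
  (aestronglyMeasurable_exp_pathIntegral h hm hW t z).mul
    (aemeasurable_pathIntegral h.continuous' hm hW t z).aestronglyMeasurable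

theorem aestronglyMeasurable_feynmanKacSpace2 (t z : ℝ) :
    AEStronglyMeasurable (fun ω => Real.exp (pathIntegral W σ φ t z ω)
      * (pathIntegral W σ φ' t z ω ^ 2 + pathIntegral W σ φ'' t z ω)) P :=
  (aestronglyMeasurable_exp_pathIntegral h hm hW t z).mul
    (((aemeasurable_pathIntegral h.continuous' hm hW t z).pow_const 2).add
      (aemeasurable_pathIntegral h.continuous'' hm hW t z)).aestronglyMeasurable

end Measurability

section Regularity

variable [IsProbabilityMeasure P] (h : IsBoundedC2 φ φ' φ'' M) (hm : ∀ t, AEMeasurable (W t) P)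
  (hW : ∀ ω, Continuous (W · ω))

include h hm hW

theorem integrable_exp_pathIntegral (t z : ℝ) :
    Integrable (fun ω => Real.exp (pathIntegral W σ φ t z ω)) P := by
  refine Integrable.of_bound (aestronglyMeasurable_exp_pathIntegral h hm hW t z)
    (Real.exp (M * |t|)) (.of_forall fun ω => ?_)
  rw [Real.norm_eq_abs, Real.abs_exp]
  exact exp_pathIntegral_le h.bound t z ω

theorem feynmanKac_pos (t z : ℝ) : 0 < feynmanKac P W σ φ t z :=
  integral_exp_pos (integrable_exp_pathIntegral h hm hW t z)

omit hm hW in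
theorem abs_feynmanKac_le (t z : ℝ) : |feynmanKac P W σ φ t z| ≤ Real.exp (M * |t|) := by
  have := norm_integral_le_of_norm_le_const (μ := P) (C := Real.exp (M * |t|))
    (f := fun ω => Real.exp (pathIntegral W σ φ t z ω)) (.of_forall fun ω => by
      rw [Real.norm_eq_abs, Real.abs_exp]; exact exp_pathIntegral_le h.bound t z ω)
  simpa [feynmanKac] using this

omit hm hW in
theorem abs_feynmanKacSpace2_le (t z : ℝ) : |feynmanKacSpace2 P W σ φ φ' φ'' t z|
    ≤ Real.exp (M * |t|) * ((M * |t|) ^ 2 + M * |t|) := by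
  have := norm_integral_le_of_norm_le_const (μ := P)
    (C := Real.exp (M * |t|) * ((M * |t|) ^ 2 + M * |t|))
    (f := fun ω => Real.exp (pathIntegral W σ φ t z ω)
      * (pathIntegral W σ φ' t z ω ^ 2 + pathIntegral W σ φ'' t z ω)) (.of_forall fun ω =>
      abs_exp_pathIntegral_mul_le h.bound t z ω (abs_pathIntegral_sq_add_le h t z ω))
  simpa [feynmanKacSpace2] using this

theorem continuous_feynmanKac :
    Continuous fun p : ℝ × ℝ => feynmanKac P W σ φ p.1 p.2 :=
  continuous_integral_of_continuous_bound (B := fun p => Real.exp (M * |p.1|))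
    (fun p => aestronglyMeasurable_exp_pathIntegral h hm hW p.1 p.2) (by fun_prop)
    (fun p ω => by rw [Real.abs_exp]; exact exp_pathIntegral_le h.bound _ _ ω)
    fun ω => (continuous_pathIntegral h.continuous (hW ω)).rexp

theorem continuous_feynmanKacTime :
    Continuous fun p : ℝ × ℝ => feynmanKacTime P W σ φ p.1 p.2 := by
  refine continuous_integral_of_continuous_bound (B := fun p => Real.exp (M * |p.1|) * M)
    (fun p => aestronglyMeasurable_feynmanKacTime h hm hW p.1 p.2) (by fun_prop)
    (fun p ω => abs_exp_pathIntegral_mul_le h.bound _ _ ω (h.bound _)) fun ω => ?_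
  have hW' : Continuous fun p : ℝ × ℝ => W p.1.toNNReal ω :=
    (hW ω).comp (continuous_real_toNNReal.comp continuous_fst)
  exact (continuous_pathIntegral h.continuous (hW ω)).rexp.mul
    (h.continuous.comp (continuous_snd.add (continuous_const.mul hW')))

theorem continuous_feynmanKacSpace :
    Continuous fun p : ℝ × ℝ => feynmanKacSpace P W σ φ φ' p.1 p.2 :=
  continuous_integral_of_continuous_bound
    (B := fun p => Real.exp (M * |p.1|) * (M * |p.1|))
    (fun p => aestronglyMeasurable_feynmanKacSpace h hm hW p.1 p.2) (by fun_prop)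
    (fun p ω => abs_exp_pathIntegral_mul_le h.bound _ _ ω (abs_pathIntegral_le h.bound' _ _ ω))
    fun ω => (continuous_pathIntegral h.continuous (hW ω)).rexp.mul
      (continuous_pathIntegral h.continuous' (hW ω))

theorem continuous_feynmanKacSpace2 :
    Continuous fun p : ℝ × ℝ => feynmanKacSpace2 P W σ φ φ' φ'' p.1 p.2 :=
  continuous_integral_of_continuous_bound
    (B := fun p => Real.exp (M * |p.1|) * ((M * |p.1|) ^ 2 + M * |p.1|))
    (fun p => aestronglyMeasurable_feynmanKacSpace2 h hm hW p.1 p.2) (by fun_prop)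
    (fun p ω => abs_exp_pathIntegral_mul_le h.bound _ _ ω (abs_pathIntegral_sq_add_le h _ _ ω))
    fun ω => (continuous_pathIntegral h.continuous (hW ω)).rexp.mul
      (((continuous_pathIntegral h.continuous' (hW ω)).pow 2).add
        (continuous_pathIntegral h.continuous'' (hW ω)))

theorem hasDerivAt_feynmanKac_time (t z : ℝ) :
    HasDerivAt (fun s => feynmanKac P W σ φ s z) (feynmanKacTime P W σ φ t z) t :=
  hasDerivAt_integral_of_continuous_bound (B := fun s => Real.exp (M * |s|))
    (B' := fun s => Real.exp (M * |s|) * M)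
    (fun s => aestronglyMeasurable_exp_pathIntegral h hm hW s z)
    (fun s => aestronglyMeasurable_feynmanKacTime h hm hW s z)
    (fun s ω => by rw [Real.abs_exp]; exact exp_pathIntegral_le h.bound _ _ ω) (by fun_prop)
    (fun s ω => abs_exp_pathIntegral_mul_le h.bound _ _ ω (h.bound _))
    (fun s ω => (hasDerivAt_pathIntegral_time h.continuous (hW ω) s z).exp) t

theorem hasDerivAt_feynmanKac_space (t z : ℝ) :
    HasDerivAt (fun y => feynmanKac P W σ φ t y) (feynmanKacSpace P W σ φ φ' t z) z :=
  hasDerivAt_integral_of_continuous_bound (B := fun _ => Real.exp (M * |t|))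
    (B' := fun _ => Real.exp (M * |t|) * (M * |t|))
    (fun y => aestronglyMeasurable_exp_pathIntegral h hm hW t y)
    (fun y => aestronglyMeasurable_feynmanKacSpace h hm hW t y)
    (fun y ω => by rw [Real.abs_exp]; exact exp_pathIntegral_le h.bound _ _ ω) (by fun_prop)
    (fun y ω => abs_exp_pathIntegral_mul_le h.bound _ _ ω (abs_pathIntegral_le h.bound' _ _ ω))
    (fun y ω =>
      (hasDerivAt_pathIntegral_space h.hasDerivAt h.continuous' h.bound' (hW ω) t y).exp) z

theorem hasDerivAt_feynmanKacSpace (t z : ℝ) :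
    HasDerivAt (fun y => feynmanKacSpace P W σ φ φ' t y)
      (feynmanKacSpace2 P W σ φ φ' φ'' t z) z := by
  refine hasDerivAt_integral_of_continuous_bound (B := fun _ => Real.exp (M * |t|) * (M * |t|))
    (B' := fun _ => Real.exp (M * |t|) * ((M * |t|) ^ 2 + M * |t|))
    (fun y => aestronglyMeasurable_feynmanKacSpace h hm hW t y)
    (fun y => aestronglyMeasurable_feynmanKacSpace2 h hm hW t y)
    (fun y ω => abs_exp_pathIntegral_mul_le h.bound _ _ ω (abs_pathIntegral_le h.bound' _ _ ω))
    (by fun_prop)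
    (fun y ω => abs_exp_pathIntegral_mul_le h.bound _ _ ω (abs_pathIntegral_sq_add_le h _ _ ω))
    (fun y ω => ?_) z
  have h1 := (hasDerivAt_pathIntegral_space (σ := σ) h.hasDerivAt h.continuous' h.bound'
    (hW ω) t y).exp
  have h2 := hasDerivAt_pathIntegral_space (σ := σ) h.hasDerivAt' h.continuous'' h.bound''
    (hW ω) t y
  refine (h1.mul h2).congr_deriv ?_
  ring

end Regularity

end FeynmanKac

/-! ### Dependence on the law of the path only -/

section Law

variable {Ω Ω' : Type*} [MeasurableSpace Ω] [MeasurableSpace Ω'] {P : Measure Ω} {P' : Measure Ω'}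
  {W : ℝ≥0 → Ω → ℝ} {X : ℝ≥0 → Ω' → ℝ} {σ M : ℝ} {φ φ' φ'' : ℝ → ℝ}

/-- The finite-dimensional laws are indexed by finsets of times, whereas a tuple may repeat times;
the tuple is read off from the restriction to its image. -/
theorem ProbabilityTheory.IsPreBrownianReal.identDistrib_pi (hW : IsPreBrownianReal W P)
    (hX : IsPreBrownianReal X P') {ι : Type*} [Fintype ι] (s : ι → ℝ≥0) :
    IdentDistrib (fun ω i => W (s i) ω) (fun ω i => X (s i) ω) P P' := by
  classical
  have h : IdentDistrib (fun ω => (Finset.univ.image s).restrict (W · ω))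
      (fun ω => (Finset.univ.image s).restrict (X · ω)) P P' :=
    ⟨(hW.hasLaw _).aemeasurable, (hX.hasLaw _).aemeasurable,
      (hW.hasLaw _).map_eq.trans (hX.hasLaw _).map_eq.symm⟩
  exact h.comp (u := fun x i => x ⟨s i, Finset.mem_image_of_mem s (Finset.mem_univ i)⟩)
    (by fun_prop)

/-- The Riemann sum approximation of `pathIntegral` as a function of the starting point and of the
values of the path on the grid. -/
noncomputable def gridSum (σ : ℝ) (φ : ℝ → ℝ) (t z : ℝ) (n : ℕ) (x : Fin n → ℝ) : ℝ :=
  t / n * ∑ k, φ (z + σ * x k)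

/-- The `n`-step grid on `[0, t]`. -/
noncomputable def grid (t : ℝ) (n : ℕ) (k : Fin n) : ℝ≥0 := (k * t / n).toNNReal

omit [MeasurableSpace Ω] in
theorem gridSum_grid (W : ℝ≥0 → Ω → ℝ) (σ : ℝ) (φ : ℝ → ℝ) (t z : ℝ) (n : ℕ) (ω : Ω) :
    gridSum σ φ t z n (fun k => W (grid t n k) ω)
      = leftRiemannSum (fun r => φ (z + σ * W r.toNNReal ω)) t n := by
  unfold gridSum leftRiemannSum grid
  rw [Finset.sum_range]

theorem continuous_gridSum (hφ : Continuous φ) (σ t : ℝ) (n : ℕ) :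
    Continuous fun p : ℝ × (Fin n → ℝ) => gridSum σ φ t p.1 n p.2 := by
  unfold gridSum
  fun_prop

theorem abs_gridSum_le (hM : ∀ x, |φ x| ≤ M) (σ t z : ℝ) (n : ℕ) (x : Fin n → ℝ) :
    |gridSum σ φ t z n x| ≤ M * |t| := by
  have hM0 : 0 ≤ M := (abs_nonneg _).trans (hM 0)
  rcases Nat.eq_zero_or_pos n with rfl | hn
  · simp [gridSum]; positivity
  have hn' : (0 : ℝ) < n := by exact_mod_cast hn
  unfold gridSum
  rw [abs_mul, abs_div, Nat.abs_cast]
  calc |t| / n * |∑ k, φ (z + σ * x k)|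
      ≤ |t| / n * (n * M) := by
        gcongr
        refine (Finset.abs_sum_le_sum_abs _ _).trans ?_
        refine (Finset.sum_le_card_nsmul _ _ M fun k _ => hM _).trans ?_
        simp
    _ = M * |t| := by field_simp

theorem exp_gridSum_le (hM : ∀ x, |φ x| ≤ M) (σ t z : ℝ) (n : ℕ) (x : Fin n → ℝ) :
    Real.exp (gridSum σ φ t z n x) ≤ Real.exp (M * |t|) :=
  Real.exp_le_exp.2 ((le_abs_self _).trans (abs_gridSum_le hM σ t z n x))

omit [MeasurableSpace Ω] in
theorem tendsto_gridSum (hφ : Continuous φ) {ω : Ω} (hW : Continuous (W · ω)) (σ t z : ℝ) :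
    Tendsto (fun n => gridSum σ φ t z n (fun k => W (grid t n k) ω)) atTop
      (𝓝 (pathIntegral W σ φ t z ω)) := by
  simp_rw [gridSum_grid]
  exact tendsto_leftRiemannSum_path hφ hW t z

theorem aemeasurable_gridSum (hφ : Continuous φ) (hm : ∀ t, AEMeasurable (W t) P) (σ t z : ℝ)
    (n : ℕ) : AEMeasurable (fun ω => gridSum σ φ t z n (fun k => W (grid t n k) ω)) P :=
  ((continuous_gridSum hφ σ t n).measurable.comp measurable_prodMk_left).comp_aemeasurable
    (aemeasurable_pi_lambda _ fun _ => hm _)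

theorem tendsto_integral_exp_gridSum [IsProbabilityMeasure P] (h : IsBoundedC2 φ φ' φ'' M)
    (hm : ∀ t, AEMeasurable (W t) P) (hc : ∀ ω, Continuous (W · ω)) (σ t z : ℝ) :
    Tendsto (fun n => ∫ ω, Real.exp (gridSum σ φ t z n (fun k => W (grid t n k) ω)) ∂P) atTop
      (𝓝 (feynmanKac P W σ φ t z)) := by
  refine tendsto_integral_of_dominated_convergence (fun _ => Real.exp (M * |t|))
    (fun n => (aemeasurable_gridSum h.continuous hm σ t z n).exp.aestronglyMeasurable)
    (integrable_const _) (fun n => .of_forall fun ω => ?_)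
    (.of_forall fun ω => (Real.continuous_exp.tendsto _).comp
      (tendsto_gridSum h.continuous (hc ω) σ t z))
  rw [Real.norm_eq_abs, Real.abs_exp]
  exact exp_gridSum_le h.bound σ t z n _

/-- Riemann sums depend on finitely many values of the path, hence have the same law under both
processes; limits are unique. -/
theorem feynmanKac_congr_law [IsProbabilityMeasure P] [IsProbabilityMeasure P']
    (h : IsBoundedC2 φ φ' φ'' M)
    (hW : IsPreBrownianReal W P) (hX : IsPreBrownianReal X P')
    (hcW : ∀ ω, Continuous (W · ω)) (hcX : ∀ ω, Continuous (X · ω)) (t z : ℝ) :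
    feynmanKac P W σ φ t z = feynmanKac P' X σ φ t z := by
  refine tendsto_nhds_unique (tendsto_integral_exp_gridSum h hW.aemeasurable hcW σ t z)
    ((tendsto_integral_exp_gridSum h hX.aemeasurable hcX σ t z).congr fun n => ?_)
  exact ((hX.identDistrib_pi hW (grid t n)).comp
    (((continuous_gridSum h.continuous σ t n).measurable.comp
      measurable_prodMk_left).exp)).integral_eq

end Law

/-! ### The Markov property -/

section Markov

variable {Ω : Type*} [MeasurableSpace Ω] {P : Measure Ω} [IsProbabilityMeasure P]
  {W : ℝ≥0 → Ω → ℝ} {σ M : ℝ} {φ φ' φ'' : ℝ → ℝ}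

/-- Discrete Markov property: the increments after time `s` are independent of the path up to `s`
and form a Brownian motion again, so Fubini integrates them out with `W s` fixed. -/
theorem integral_exp_gridSum_mul (h : IsBoundedC2 φ φ' φ'' M) (hW : IsPreBrownianReal W P)
    (s t : ℝ≥0) (z : ℝ) (m n : ℕ) :
    ∫ ω, Real.exp (gridSum σ φ s z m (fun k => W (grid s m k) ω))
        * Real.exp (gridSum σ φ t (z + σ * W s ω) n
            (fun k => W (s + grid t n k) ω - W s ω)) ∂P
      = ∫ ω, Real.exp (gridSum σ φ s z m (fun k => W (grid s m k) ω))
        * ∫ ω', Real.exp (gridSum σ φ t (z + σ * W s ω) n (fun k => W (grid t n k) ω')) ∂P ∂P := by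
  set Y : Ω → ℝ × ℝ := fun ω => (gridSum σ φ s z m (fun k => W (grid s m k) ω), W s ω) with hY
  set X : Ω → Fin n → ℝ := fun ω k => W (s + grid t n k) ω - W s ω with hX
  -- The first grid lies in `[0, s]`, which makes `Y` a function of the path up to time `s`.
  have hgrid : ∀ k, grid s m k ≤ s := fun k => by
    rw [grid, Real.toNNReal_le_iff_le_coe]
    have hm : (0 : ℝ) < m := by exact_mod_cast k.pos
    rw [div_le_iff₀ hm, mul_comm]
    gcongr
    exact k.2.le
  have hind : IndepFun Y X P := by
    have hmeas : Measurable fun w : Set.Iic s → ℝ =>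
        (gridSum σ φ s z m (fun k => w ⟨grid s m k, hgrid k⟩), w ⟨s, Set.self_mem_Iic⟩) := by
      refine Measurable.prodMk ?_ (by fun_prop)
      exact ((continuous_gridSum h.continuous σ s m).measurable.comp
        measurable_prodMk_left).comp (by fun_prop)
    exact (hW.indepFun_shift s).symm.comp hmeas
      (by fun_prop : Measurable fun (w : ℝ≥0 → ℝ) (k : Fin n) => w (grid t n k))
  have hYm : AEMeasurable Y P :=
    (aemeasurable_gridSum h.continuous hW.aemeasurable σ s z m).prodMk (hW.aemeasurable s)
  have hXm : AEMeasurable X P :=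
    aemeasurable_pi_lambda _ fun k => (hW.aemeasurable _).sub (hW.aemeasurable s)
  have hlaw : P.map X = P.map (fun ω k => W (grid t n k) ω) :=
    ((hW.shift s).identDistrib_pi hW (grid t n)).map_eq
  have hW0m : AEMeasurable (fun ω (k : Fin n) => W (grid t n k) ω) P :=
    aemeasurable_pi_lambda _ fun k => hW.aemeasurable _
  -- truncate the first factor so that the integrand on the product space is bounded
  set T : ℝ → ℝ := fun a => Real.exp (min a (M * |(s : ℝ)|)) with hT
  have hTm : Measurable T := by fun_prop
  have hTe : ∀ ω, T (Y ω).1 = Real.exp (Y ω).1 := fun ω => by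
    rw [hT]
    simp only
    rw [min_eq_left ((le_abs_self _).trans (abs_gridSum_le h.bound _ _ _ _ _))]
  set H : (ℝ × ℝ) × (Fin n → ℝ) → ℝ :=
    fun p => T p.1.1 * Real.exp (gridSum σ φ t (z + σ * p.1.2) n p.2) with hH
  have hHm : Measurable H := by
    refine (hTm.comp (by fun_prop)).mul (Measurable.exp ?_)
    exact (continuous_gridSum h.continuous σ t n).measurable.comp
      (Measurable.prodMk (by fun_prop) (by fun_prop))
  have : IsProbabilityMeasure (P.map Y) := Measure.isProbabilityMeasure_map hYm
  have : IsProbabilityMeasure (P.map X) := Measure.isProbabilityMeasure_map hXm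
  have hHi : Integrable H ((P.map Y).prod (P.map X)) := by
    refine Integrable.of_bound hHm.aestronglyMeasurable
      (Real.exp (M * |(s : ℝ)|) * Real.exp (M * |(t : ℝ)|)) (.of_forall fun p => ?_)
    rw [hH, Real.norm_eq_abs, abs_mul, Real.abs_exp, Real.abs_exp]
    gcongr
    · exact min_le_right _ _
    · exact (le_abs_self _).trans (abs_gridSum_le h.bound _ _ _ _ _)
  calc _ = ∫ ω, H (Y ω, X ω) ∂P := by
        refine integral_congr_ae (.of_forall fun ω => ?_)
        simp only [hH, hTe]
        rfl
    _ = ∫ p, H p ∂(P.map fun ω => (Y ω, X ω)) :=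
        (integral_map (hYm.prodMk hXm) hHm.aestronglyMeasurable).symm
    _ = ∫ p, H p ∂((P.map Y).prod (P.map X)) := by rw [hind.map_prod_eq_prod_map_map hYm hXm]
    _ = ∫ y, ∫ x, H (y, x) ∂(P.map X) ∂(P.map Y) := integral_prod _ hHi
    _ = ∫ ω, ∫ x, H (Y ω, x) ∂(P.map X) ∂P :=
        integral_map hYm hHm.stronglyMeasurable.integral_prod_right.aestronglyMeasurable
    _ = _ := by
        refine integral_congr_ae (.of_forall fun ω => ?_)
        simp only [hH, hTe, integral_const_mul]
        rw [hlaw, integral_map hW0m]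
        refine (Measurable.exp ?_).aestronglyMeasurable
        exact (continuous_gridSum h.continuous σ t n).measurable.comp measurable_prodMk_left

/-- The Markov property for the Feynman--Kac functional. -/
theorem feynmanKac_add (h : IsBoundedC2 φ φ' φ'' M) (hW : IsPreBrownianReal W P)
    (hc : ∀ ω, Continuous (W · ω)) (s t : ℝ≥0) (z : ℝ) :
    feynmanKac P W σ φ (s + t) z
      = ∫ ω, Real.exp (pathIntegral W σ φ s z ω)
          * feynmanKac P W σ φ t (z + σ * W s ω) ∂P := by
  have hcX : ∀ ω, Continuous fun r => W (s + r) ω - W s ω := fun ω =>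
    ((hc ω).comp (continuous_const.add continuous_id)).sub continuous_const
  have hmX : ∀ r, AEMeasurable (fun ω => W (s + r) ω - W s ω) P := fun r =>
    (hW.aemeasurable _).sub (hW.aemeasurable s)
  have hkey := fun n => integral_exp_gridSum_mul (σ := σ) h hW s t z n n
  have hmeas1 : ∀ n, AEStronglyMeasurable
      (fun ω => Real.exp (gridSum σ φ s z n (fun k => W (grid s n k) ω))) P := fun n =>
    (aemeasurable_gridSum h.continuous hW.aemeasurable σ s z n).exp.aestronglyMeasurable
  have hbound : ∀ (n : ℕ) (ω : Ω) (a : ℝ), |a| ≤ Real.exp (M * |(t : ℝ)|) →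
      ‖Real.exp (gridSum σ φ s z n (fun k => W (grid s n k) ω)) * a‖
        ≤ Real.exp (M * |(s : ℝ)|) * Real.exp (M * |(t : ℝ)|) := fun n ω a ha => by
    rw [norm_mul, Real.norm_eq_abs, Real.norm_eq_abs, Real.abs_exp]
    exact mul_le_mul (exp_gridSum_le h.bound _ _ _ _ _) ha (abs_nonneg _) (Real.exp_pos _).le
  -- Both sides are limits of one sequence, the second after rewriting it by the discrete Markov
  -- property.
  refine tendsto_nhds_unique (f := fun n : ℕ =>
    ∫ ω, Real.exp (gridSum σ φ s z n (fun k => W (grid s n k) ω))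
        * Real.exp (gridSum σ φ t (z + σ * W s ω) n
            (fun k => W (s + grid t n k) ω - W s ω)) ∂P) (l := atTop) ?_ ?_
  · refine tendsto_integral_of_dominated_convergence
      (fun _ => Real.exp (M * |(s : ℝ)|) * Real.exp (M * |(t : ℝ)|)) (fun n => ?_)
      (integrable_const _) (fun n => .of_forall fun ω => hbound n ω _ ?_)
      (.of_forall fun ω => ?_)
    · refine (hmeas1 n).mul (AEMeasurable.exp ?_).aestronglyMeasurable
      exact (continuous_gridSum h.continuous σ t n).measurable.comp_aemeasurable
        ((((hW.aemeasurable s).const_mul σ).const_add z).prodMk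
          (aemeasurable_pi_lambda _ fun k => hmX _))
    · rw [Real.abs_exp]
      exact exp_gridSum_le h.bound _ _ _ _ _
    · rw [pathIntegral_add h.continuous (hc ω), Real.exp_add]
      exact ((Real.continuous_exp.tendsto _).comp (tendsto_gridSum h.continuous (hc ω) σ s z)).mul
        ((Real.continuous_exp.tendsto _).comp
          (tendsto_gridSum (W := fun r ω => W (s + r) ω - W s ω) h.continuous (hcX ω) σ t _))
  · simp_rw [hkey]
    -- Continuity in the starting point makes the inner expectation measurable once `z + σ * W s ω`
    -- is substituted.
    have hin : ∀ (n : ℕ), Continuous fun y : ℝ =>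
        ∫ ω', Real.exp (gridSum σ φ t y n (fun k => W (grid t n k) ω')) ∂P := fun n => by
      refine continuous_integral_of_continuous_bound (B := fun _ => Real.exp (M * |(t : ℝ)|))
        (fun y => (aemeasurable_gridSum h.continuous
          hW.aemeasurable σ t y n).exp.aestronglyMeasurable) (by fun_prop) (fun y ω => ?_)
        fun ω => Real.continuous_exp.comp
          ((continuous_gridSum h.continuous σ t n).comp (by fun_prop :
            Continuous fun y : ℝ => (y, fun k => W (grid t n k) ω)))
      rw [Real.abs_exp]
      exact exp_gridSum_le h.bound _ _ _ _ _
    refine tendsto_integral_of_dominated_convergence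
      (fun _ => Real.exp (M * |(s : ℝ)|) * Real.exp (M * |(t : ℝ)|)) (fun n => ?_)
      (integrable_const _) (fun n => .of_forall fun ω => hbound n ω _ ?_)
      (.of_forall fun ω => ?_)
    · exact (hmeas1 n).mul ((hin n).measurable.comp_aemeasurable
        (((hW.aemeasurable s).const_mul σ).const_add z)).aestronglyMeasurable
    · have := norm_integral_le_of_norm_le_const (μ := P) (C := Real.exp (M * |(t : ℝ)|))
        (f := fun ω' => Real.exp (gridSum σ φ t (z + σ * W s ω) n (fun k => W (grid t n k) ω')))
        (.of_forall fun ω' => by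
          rw [Real.norm_eq_abs, Real.abs_exp]; exact exp_gridSum_le h.bound _ _ _ _ _)
      simpa using this
    · exact ((Real.continuous_exp.tendsto _).comp
        (tendsto_gridSum h.continuous (hc ω) σ s z)).mul
        (tendsto_integral_exp_gridSum h hW.aemeasurable hc σ t _)

end Markov

/-! ### Small-time expansion of Gaussian averages -/

section Generator

/-- The averaged second derivative appearing in the second order Taylor remainder. -/
noncomputable def taylorKernel (f'' : ℝ → ℝ) (z y : ℝ) : ℝ :=
  ∫ u in (0 : ℝ)..1, (1 - u) * f'' (z + u * y)

variable {f f' f'' : ℝ → ℝ}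

theorem eq_add_taylorKernel (hf : ∀ x, HasDerivAt f (f' x) x) (hf' : ∀ x, HasDerivAt f' (f'' x) x)
    (hf'' : Continuous f'') (z y : ℝ) :
    f (z + y) = f z + f' z * y + y ^ 2 * taylorKernel f'' z y := by
  -- This antiderivative telescopes: differentiating it cancels the first-order terms and leaves the
  -- Taylor remainder.
  have hd : ∀ u : ℝ, HasDerivAt (fun u => f (z + u * y) + (1 - u) * y * f' (z + u * y))
      (y ^ 2 * ((1 - u) * f'' (z + u * y))) u := fun u => by
    have hl : HasDerivAt (fun u : ℝ => z + u * y) y u := by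
      simpa using ((hasDerivAt_id u).mul_const y).const_add z
    have h1 := (hf (z + u * y)).comp u hl
    have h2 := (hf' (z + u * y)).comp u hl
    have h3 : HasDerivAt (fun u : ℝ => (1 - u) * y) (-y) u := by
      simpa using ((hasDerivAt_id u).const_sub 1).mul_const y
    refine (h1.add (h3.mul h2)).congr_deriv ?_
    simp only [Function.comp_apply]
    ring
  have := intervalIntegral.integral_eq_sub_of_hasDerivAt (a := 0) (b := 1) (fun u _ => hd u)
    (Continuous.intervalIntegrable (by fun_prop) _ _)
  rw [intervalIntegral.integral_const_mul] at this
  unfold taylorKernel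
  rw [this]
  simp
  ring

theorem continuous_taylorKernel (hf'' : Continuous f'') (z : ℝ) :
    Continuous (taylorKernel f'' z) :=
  intervalIntegral.continuous_parametric_intervalIntegral_of_continuous' (by fun_prop) _ _

theorem taylorKernel_zero (f'' : ℝ → ℝ) (z : ℝ) : taylorKernel f'' z 0 = f'' z / 2 := by
  unfold taylorKernel
  simp only [mul_zero, add_zero]
  rw [intervalIntegral.integral_mul_const, intervalIntegral.integral_sub (by simp) (by simp)]
  simp
  ring

theorem abs_taylorKernel_le {M : ℝ} (hM : ∀ x, |f'' x| ≤ M) (z y : ℝ) :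
    |taylorKernel f'' z y| ≤ M := by
  have := intervalIntegral.norm_integral_le_of_norm_le_const (a := 0) (b := 1) (C := M)
    (f := fun u => (1 - u) * f'' (z + u * y)) fun u hu => by
      rw [Set.uIoc_of_le zero_le_one] at hu
      rw [norm_mul, Real.norm_eq_abs, Real.norm_eq_abs, abs_of_nonneg (by linarith [hu.2])]
      nlinarith [hM (z + u * y), abs_nonneg (f'' (z + u * y)), hu.1, hu.2]
  simpa [taylorKernel] using this

/-- Scaling to the standard Gaussian keeps the measure fixed as `s → 0`. The linear Taylor term has
mean zero, and `(√s x)²` yields the factor `s`. -/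
theorem integral_gaussianReal_shift (hf : ∀ x, HasDerivAt f (f' x) x)
    (hf' : ∀ x, HasDerivAt f' (f'' x) x) (hf'' : Continuous f'') {M : ℝ} (hM : ∀ x, |f'' x| ≤ M)
    (σ z : ℝ) (s : ℝ≥0) :
    ∫ x, f (z + σ * x) ∂(gaussianReal 0 s)
      = f z + s * ∫ x, σ ^ 2 * x ^ 2 * taylorKernel f'' z (σ * (√s * x)) ∂(gaussianReal 0 1) := by
  have hfc : Continuous f := continuous_iff_continuousAt.2 fun x => (hf x).continuousAt
  have hmap : gaussianReal 0 s = (gaussianReal 0 1).map (fun x => √s * x) := by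
    rw [gaussianReal_map_const_mul]
    congr 1
    · simp
    · ext
      simp
  have hsq : Integrable (fun x : ℝ => x ^ 2) (gaussianReal 0 1) :=
    (memLp_id_gaussianReal 2).integrable_sq
  have hid : Integrable (fun x : ℝ => x) (gaussianReal 0 1) :=
    (memLp_id_gaussianReal 1).integrable le_rfl
  have hR : Integrable (fun x : ℝ => σ ^ 2 * x ^ 2 * taylorKernel f'' z (σ * (√s * x)))
      (gaussianReal 0 1) := by
    refine Integrable.mul_bdd (c := M) (hsq.const_mul _) ?_
      (.of_forall fun x => abs_taylorKernel_le hM _ _)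
    exact ((continuous_taylorKernel hf'' z).comp (by fun_prop)).aestronglyMeasurable
  rw [hmap, integral_map (by fun_prop) (Continuous.aestronglyMeasurable (by fun_prop))]
  have hexp : ∀ x : ℝ, f (z + σ * (√s * x)) = f z + f' z * σ * √s * x
      + s * (σ ^ 2 * x ^ 2 * taylorKernel f'' z (σ * (√s * x))) := fun x => by
    rw [eq_add_taylorKernel hf hf' hf'']
    have : (√(s : ℝ)) ^ 2 = s := Real.sq_sqrt s.coe_nonneg
    linear_combination (σ ^ 2 * x ^ 2 * taylorKernel f'' z (σ * (√s * x))) * this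
  simp_rw [hexp]
  have hlin : Integrable (fun x : ℝ => f z + f' z * σ * √s * x) (gaussianReal 0 1) :=
    (integrable_const _).add (hid.const_mul _)
  rw [integral_add hlin (hR.const_mul _), integral_add (integrable_const _) (hid.const_mul _), integral_const_mul, integral_const_mul,
    integral_id_gaussianReal]
  simp

/-- Dominated convergence with majorant `σ² x² M`; the factor `1/2` is the Taylor kernel at `0`, and
the Gaussian second moment is `1`. -/
theorem tendsto_generator (hf'' : Continuous f'') {M : ℝ}
    (hM : ∀ x, |f'' x| ≤ M) (σ z : ℝ) :
    Tendsto (fun s : ℝ => ∫ x, σ ^ 2 * x ^ 2 * taylorKernel f'' z (σ * (√s * x))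
      ∂(gaussianReal 0 1)) (𝓝[>] 0) (𝓝 (σ ^ 2 / 2 * f'' z)) := by
  have hsq : Integrable (fun x : ℝ => x ^ 2) (gaussianReal 0 1) :=
    (memLp_id_gaussianReal 2).integrable_sq
  have hsq1 : ∫ x : ℝ, x ^ 2 ∂(gaussianReal 0 1) = 1 := by
    have := variance_id_gaussianReal (μ := 0) (v := 1)
    rw [variance_of_integral_eq_zero aemeasurable_id integral_id_gaussianReal] at this
    simpa using this
  have hlim : ∫ x : ℝ, σ ^ 2 * x ^ 2 * (f'' z / 2) ∂(gaussianReal 0 1) = σ ^ 2 / 2 * f'' z := by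
    rw [integral_mul_const, integral_const_mul, hsq1]
    ring
  rw [← hlim]
  refine tendsto_integral_filter_of_dominated_convergence (fun x => σ ^ 2 * x ^ 2 * M)
    (.of_forall fun s => ?_) (.of_forall fun s => .of_forall fun x => ?_)
    ((hsq.const_mul _).mul_const _) (.of_forall fun x => ?_)
  · exact Continuous.aestronglyMeasurable ((by fun_prop : Continuous fun x : ℝ =>
      σ ^ 2 * x ^ 2).mul ((continuous_taylorKernel hf'' z).comp (by fun_prop)))
  · rw [Real.norm_eq_abs, abs_mul, abs_of_nonneg (by positivity)]
    gcongr
    exact abs_taylorKernel_le hM _ _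
  · refine Tendsto.const_mul _ ?_
    rw [← taylorKernel_zero]
    have hc : Continuous fun s : ℝ => taylorKernel f'' z (σ * (√s * x)) :=
      (continuous_taylorKernel hf'' z).comp (by fun_prop)
    refine (hc.tendsto' 0 _ (by simp)).mono_left nhdsWithin_le_nhds

end Generator

/-! ### The Feynman–Kac equation -/

section Equation

variable {Ω : Type*} [MeasurableSpace Ω] {P : Measure Ω} [IsProbabilityMeasure P]
  {W : ℝ≥0 → Ω → ℝ} {σ M : ℝ} {φ φ' φ'' : ℝ → ℝ}

theorem abs_exp_sub_one_le_abs_mul_exp_abs (x : ℝ) : |Real.exp x - 1| ≤ |x| * Real.exp |x| := by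
  have h1 : 1 ≤ Real.exp |x| := Real.one_le_exp (abs_nonneg x)
  rw [abs_le]
  constructor
  · nlinarith [Real.add_one_le_exp x, neg_abs_le x, abs_nonneg x]
  · rcases le_total 0 x with hx | hx
    · rw [abs_of_nonneg hx]
      have h2 : Real.exp x * Real.exp (-x) = 1 := by rw [← Real.exp_add]; simp
      nlinarith [Real.add_one_le_exp (-x), Real.exp_pos x]
    · have := Real.exp_le_one_iff.2 hx
      nlinarith [abs_nonneg x]

/-- Along each path the slope of `exp A_s` at `0` tends to `φ(z + σ W_0)`, and for `s ≤ 1` it is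
bounded by `M exp M`. -/
theorem tendsto_integral_slope_exp_mul (h : IsBoundedC2 φ φ' φ'' M) (hW : IsPreBrownianReal W P)
    (hc : ∀ ω, Continuous (W · ω)) {f : ℝ → ℝ} (hf : Continuous f) {B : ℝ} (hB : ∀ x, |f x| ≤ B)
    (z : ℝ) :
    Tendsto (fun s : ℝ => ∫ ω, (s⁻¹ * (Real.exp (pathIntegral W σ φ s z ω) - 1))
      * f (z + σ * W s.toNNReal ω) ∂P) (𝓝[>] 0) (𝓝 (φ z * f z)) := by
  have hM := h.nonneg
  -- The pathwise limit involves `W 0 ω`, which vanishes only almost surely.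
  have h0 : ∫ ω, φ (z + σ * W 0 ω) * f (z + σ * W 0 ω) ∂P = φ z * f z := by
    rw [integral_congr_ae (g := fun _ => φ z * f z)]
    · simp
    · filter_upwards [hW.eval_zero_ae_eq_zero] with ω hω
      simp [hω]
  rw [← h0]
  have hsmall : Set.Ioc (0 : ℝ) 1 ∈ 𝓝[>] (0 : ℝ) := Ioc_mem_nhdsGT one_pos
  refine tendsto_integral_filter_of_dominated_convergence (fun _ => (M * Real.exp M) * B)
    (.of_forall fun s => ?_) ?_ (integrable_const _) (.of_forall fun ω => ?_)
  · refine AEMeasurable.aestronglyMeasurable (AEMeasurable.mul ?_ ?_)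
    · exact (((aemeasurable_pathIntegral h.continuous hW.aemeasurable hc s z).exp).sub_const
        1).const_mul _
    · exact hf.measurable.comp_aemeasurable (((hW.aemeasurable _).const_mul σ).const_add z)
  · filter_upwards [hsmall] with s hs
    refine .of_forall fun ω => ?_
    have hs0 : 0 < s := hs.1
    have hA := abs_pathIntegral_le (W := W) (σ := σ) h.bound s z ω
    rw [abs_of_pos hs0] at hA
    have hexp : |Real.exp (pathIntegral W σ φ s z ω) - 1| ≤ M * s * Real.exp M := by
      refine (abs_exp_sub_one_le_abs_mul_exp_abs _).trans ?_
      gcongr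
      exact hA.trans (mul_le_of_le_one_right hM hs.2)
    rw [norm_mul, norm_mul, Real.norm_eq_abs, Real.norm_eq_abs, Real.norm_eq_abs, abs_inv,
      abs_of_pos hs0]
    refine mul_le_mul ?_ (hB _) (abs_nonneg _) (by positivity)
    calc s⁻¹ * |Real.exp (pathIntegral W σ φ s z ω) - 1| ≤ s⁻¹ * (M * s * Real.exp M) := by gcongr
      _ = M * Real.exp M := by field_simp
  · have hd := (hasDerivAt_pathIntegral_time (σ := σ) h.continuous (hc ω) 0 z).exp
    have hz : pathIntegral W σ φ 0 z ω = 0 := by simp [pathIntegral]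
    rw [hz, Real.exp_zero, one_mul, Real.toNNReal_zero] at hd
    have hs' := hd.tendsto_slope_zero_right
    simp only [zero_add, hz, Real.exp_zero, smul_eq_mul] at hs'
    refine hs'.mul ?_
    have hW' : Continuous fun r : ℝ => W r.toNNReal ω := (hc ω).comp continuous_real_toNNReal
    have hcf : Continuous fun s : ℝ => f (z + σ * W s.toNNReal ω) := by fun_prop
    exact (hcf.tendsto' 0 _ (by simp)).mono_left nhdsWithin_le_nhds

/-- The **Feynman--Kac equation**. -/
theorem feynmanKacTime_eq (h : IsBoundedC2 φ φ' φ'' M) (hW : IsPreBrownianReal W P)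
    (hc : ∀ ω, Continuous (W · ω)) {t : ℝ} (ht : 0 ≤ t) (z : ℝ) :
    feynmanKacTime P W σ φ t z
      = σ ^ 2 / 2 * feynmanKacSpace2 P W σ φ φ' φ'' t z + φ z * feynmanKac P W σ φ t z := by
  lift t to ℝ≥0 using ht
  have hm := hW.aemeasurable
  set f : ℝ → ℝ := fun y => feynmanKac P W σ φ t y with hf
  have hfc : Continuous f := (continuous_feynmanKac h hm hc).comp (Continuous.prodMk_right _)
  have hfb : ∀ x, |f x| ≤ Real.exp (M * |(t : ℝ)|) := abs_feynmanKac_le h t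
  have hf2c : Continuous fun y => feynmanKacSpace2 P W σ φ φ' φ'' t y :=
    (continuous_feynmanKacSpace2 h hm hc).comp (Continuous.prodMk_right _)
  have hf2b := abs_feynmanKacSpace2_le (P := P) (W := W) (σ := σ) h t
  -- The time derivative is known to exist, so computing the limit along `s ↓ 0`, where the Markov
  -- property applies, is enough.
  have hslope : Tendsto (fun s : ℝ => s⁻¹ * (feynmanKac P W σ φ (s + t) z - feynmanKac P W σ φ t z))
      (𝓝[>] 0) (𝓝 (feynmanKacTime P W σ φ t z)) := by
    have hd := (hasDerivAt_feynmanKac_time (σ := σ) h hm hc t z).tendsto_slope_zero_right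
    simpa [add_comm] using hd
  refine tendsto_nhds_unique hslope ?_
  have hlim := (tendsto_generator hf2c hf2b σ z).add
    (tendsto_integral_slope_exp_mul (σ := σ) h hW hc hfc hfb z)
  refine hlim.congr' ?_
  filter_upwards [self_mem_nhdsWithin] with s hs
  have hs0 : (0 : ℝ) < s := hs
  lift s to ℝ≥0 using hs0.le
  have hs' : (s : ℝ) ≠ 0 := hs0.ne'
  have hlaw : ∫ ω, f (z + σ * W s ω) ∂P = ∫ x, f (z + σ * x) ∂(gaussianReal 0 s) := by
    rw [← (hW.hasLaw_eval s).map_eq, integral_map (hm s)]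
    exact Continuous.aestronglyMeasurable (by fun_prop)
  have hsh := integral_gaussianReal_shift (f := f) (f'' := fun y =>
    feynmanKacSpace2 P W σ φ φ' φ'' t y) (fun x => hasDerivAt_feynmanKac_space (σ := σ) h hm hc t x)
    (fun x => hasDerivAt_feynmanKacSpace (σ := σ) h hm hc t x) hf2c hf2b σ z s
  have hfm : AEStronglyMeasurable (fun ω => f (z + σ * W s ω)) P :=
    (hfc.measurable.comp_aemeasurable (((hm s).const_mul σ).const_add z)).aestronglyMeasurable
  have hfi : Integrable (fun ω => f (z + σ * W s ω)) P :=
    Integrable.of_bound hfm _ (.of_forall fun ω => hfb _)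
  have hei : Integrable (fun ω => Real.exp (pathIntegral W σ φ s z ω) * f (z + σ * W s ω)) P :=
    (integrable_exp_pathIntegral h hm hc s z).mul_bdd hfm (.of_forall fun ω => hfb _)
  -- The Markov property, with the average of `f(z + σ W_s)` subtracted: the rest of the increment
  -- is the Gaussian part.
  have hsplit : ∫ ω, ((s : ℝ)⁻¹ * (Real.exp (pathIntegral W σ φ s z ω) - 1))
      * f (z + σ * W (s : ℝ).toNNReal ω) ∂P
      = (s : ℝ)⁻¹ * (feynmanKac P W σ φ (s + t) z - ∫ ω, f (z + σ * W s ω) ∂P) := by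
    rw [feynmanKac_add h hW hc, ← integral_sub hei hfi, ← integral_const_mul]
    refine integral_congr_ae (.of_forall fun ω => ?_)
    simp only [Real.toNNReal_coe, hf]
    ring
  rw [hsplit, hlaw, hsh]
  generalize (∫ x : ℝ, σ ^ 2 * x ^ 2 * taylorKernel (fun y => feynmanKacSpace2 P W σ φ φ' φ'' t y) z
    (σ * (√(s : ℝ) * x)) ∂(gaussianReal 0 1)) = A
  simp only [hf]
  field_simp
  ring

end Equation

/-! ### Reflection about `c` and the Neumann condition -/

section Symmetry

variable {Ω : Type*} [MeasurableSpace Ω] {P : Measure Ω} [IsProbabilityMeasure P]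
  {W : ℝ≥0 → Ω → ℝ} {σ M : ℝ} {φ φ' φ'' : ℝ → ℝ}

/-- Replacing `W` by `-W` keeps the law, and reflecting the path about `c` keeps `φ`. -/
theorem feynmanKac_symm (h : IsBoundedC2 φ φ' φ'' M) (hW : IsPreBrownianReal W P)
    (hc : ∀ ω, Continuous (W · ω)) {c : ℝ} (hsymm : ∀ x, φ (c + x) = φ (c - x)) (t y : ℝ) :
    feynmanKac P W σ φ t (c + y) = feynmanKac P W σ φ t (c - y) := by
  rw [feynmanKac_congr_law h hW hW.neg hc (fun ω => (hc ω).neg : ∀ ω, Continuous ((-W) · ω))]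
  unfold feynmanKac pathIntegral
  refine integral_congr_ae (.of_forall fun ω => congrArg Real.exp ?_)
  refine intervalIntegral.integral_congr fun r _ => ?_
  have := hsymm (y + σ * (-W) r.toNNReal ω)
  rw [← add_assoc] at this
  rw [this]
  congr 1
  simp only [Pi.neg_apply]
  ring

theorem feynmanKacSpace_eq_zero (h : IsBoundedC2 φ φ' φ'' M) (hW : IsPreBrownianReal W P)
    (hc : ∀ ω, Continuous (W · ω)) {c : ℝ} (hsymm : ∀ x, φ (c + x) = φ (c - x)) (t : ℝ) :
    feynmanKacSpace P W σ φ φ' t c = 0 := by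
  have hd := hasDerivAt_feynmanKac_space (σ := σ) h hW.aemeasurable hc t c
  have h1 : HasDerivAt (fun y => feynmanKac P W σ φ t (c + y)) (feynmanKacSpace P W σ φ φ' t c) 0 :=
    HasDerivAt.comp_const_add c 0 (by simpa using hd)
  have h2 : HasDerivAt (fun y => feynmanKac P W σ φ t (c - y))
      (-feynmanKacSpace P W σ φ φ' t c) 0 := HasDerivAt.comp_const_sub c 0 (by simpa using hd)
  simp_rw [← feynmanKac_symm h hW hc hsymm] at h2
  linarith [h1.unique h2]

end Symmetry

/-! ### Bounds on the Gaussian kernel -/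

section GaussKernel

theorem mul_exp_neg_le_one (u : ℝ) : u * Real.exp (-u) ≤ 1 := by
  have h : Real.exp u * Real.exp (-u) = 1 := by rw [← Real.exp_add]; simp
  nlinarith [Real.add_one_le_exp u, Real.exp_pos (-u)]

/-- The derivatives are polynomials in `x - c` of degree at most two times the Gaussian; `u exp(-u)
≤ 1` with `u = (x - c)²/(2ε)` controls them. -/
theorem exists_isBoundedC2_gaussKernel (c β : ℝ) {ε : ℝ} (hε : 0 < ε) :
    ∃ φ' φ'' M, IsBoundedC2 (fun x => β * gaussKernel c ε x) φ' φ'' M := by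
  set k : ℝ := β * (1 / √(2 * Real.pi * ε)) with hk
  have hφ : ∀ x, β * gaussKernel c ε x = k * Real.exp (-((x - c) ^ 2 / (2 * ε))) := fun x => by
    rw [gaussKernel, hk, neg_div]
    ring
  have hd0 : ∀ x, HasDerivAt (fun x => k * Real.exp (-((x - c) ^ 2 / (2 * ε))))
      (-((x - c) / ε) * (k * Real.exp (-((x - c) ^ 2 / (2 * ε))))) x := fun x => by
    have h1 : HasDerivAt (fun x : ℝ => -((x - c) ^ 2 / (2 * ε))) (-((x - c) / ε)) x := by
      refine ((((hasDerivAt_id x).sub_const c).pow 2).div_const (2 * ε)).neg.congr_deriv ?_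
      simp only [id]
      field_simp
      simp [mul_comm]
    refine (h1.exp.const_mul k).congr_deriv ?_
    ring
  have hexp : ∀ x, Real.exp (-((x - c) ^ 2 / (2 * ε))) ≤ 1 := fun x =>
    Real.exp_le_one_iff.2 (neg_nonpos.2 (by positivity))
  have hsq : ∀ x, (x - c) ^ 2 * Real.exp (-((x - c) ^ 2 / (2 * ε))) ≤ 2 * ε := fun x => by
    have h2 := mul_le_mul_of_nonneg_left (mul_exp_neg_le_one ((x - c) ^ 2 / (2 * ε)))
      (by positivity : 0 ≤ 2 * ε)
    rw [← mul_assoc, mul_div_cancel₀ _ (by positivity : 2 * ε ≠ 0), mul_one] at h2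
    exact h2
  have hlin : ∀ x, |x - c| * Real.exp (-((x - c) ^ 2 / (2 * ε))) ≤ 1 + 2 * ε := fun x => by
    have h1 : |x - c| ≤ 1 + (x - c) ^ 2 := by
      rw [← sq_abs]; nlinarith [sq_nonneg (|x - c| - 1), abs_nonneg (x - c)]
    nlinarith [hexp x, hsq x, Real.exp_pos (-((x - c) ^ 2 / (2 * ε)))]
  -- The three summands bound `φ`, `φ'` and `φ''` in turn.
  set M : ℝ := |k| * (1 + (1 + 2 * ε) / ε + (2 * ε / ε ^ 2 + 1 / ε)) with hM
  refine ⟨fun x => -((x - c) / ε) * (k * Real.exp (-((x - c) ^ 2 / (2 * ε)))),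
    fun x => ((x - c) ^ 2 / ε ^ 2 - 1 / ε) * (k * Real.exp (-((x - c) ^ 2 / (2 * ε)))), M, ?_⟩
  simp_rw [hφ]
  refine ⟨hd0, fun x => ?_, by fun_prop, fun x => ?_, fun x => ?_, fun x => ?_⟩
  · have h1 : HasDerivAt (fun x : ℝ => -((x - c) / ε)) (-(1 / ε)) x :=
      (((hasDerivAt_id x).sub_const c).div_const ε).neg
    refine (h1.mul (hd0 x)).congr_deriv ?_
    field_simp
    ring
  · rw [abs_mul, Real.abs_exp, hM]
    refine mul_le_mul_of_nonneg_left ((hexp x).trans ?_) (abs_nonneg k)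
    rw [add_assoc]
    exact le_add_of_nonneg_right (by positivity)
  · calc _ = |k| * (|x - c| * Real.exp (-((x - c) ^ 2 / (2 * ε))) / ε) := by
          rw [abs_mul, abs_mul, abs_neg, abs_div, Real.abs_exp, abs_of_pos hε]; ring
      _ ≤ |k| * ((1 + 2 * ε) / ε) := by gcongr; exact hlin x
      _ ≤ M := by
          refine mul_le_mul_of_nonneg_left ?_ (abs_nonneg k)
          have : 0 ≤ 2 * ε / ε ^ 2 + 1 / ε := by positivity
          linarith
  · have hE := Real.exp_pos (-((x - c) ^ 2 / (2 * ε)))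
    calc _ ≤ |k| * ((x - c) ^ 2 * Real.exp (-((x - c) ^ 2 / (2 * ε))) / ε ^ 2
            + Real.exp (-((x - c) ^ 2 / (2 * ε))) / ε) := by
          rw [abs_mul, abs_mul, Real.abs_exp]
          have h3 : |(x - c) ^ 2 / ε ^ 2 - 1 / ε| ≤ (x - c) ^ 2 / ε ^ 2 + 1 / ε := by
            refine (abs_sub _ _).trans (le_of_eq ?_)
            rw [abs_of_nonneg (by positivity), abs_of_nonneg (by positivity)]
          calc _ ≤ ((x - c) ^ 2 / ε ^ 2 + 1 / ε)
                * (|k| * Real.exp (-((x - c) ^ 2 / (2 * ε)))) := by gcongr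
            _ = _ := by ring
      _ ≤ |k| * (2 * ε / ε ^ 2 + 1 / ε) := by
          refine mul_le_mul_of_nonneg_left (add_le_add ?_ ?_) (abs_nonneg k)
          · exact div_le_div_of_nonneg_right (hsq x) (by positivity)
          · exact div_le_div_of_nonneg_right (hexp x) hε.le
      _ ≤ M := by
          refine mul_le_mul_of_nonneg_left ?_ (abs_nonneg k)
          have : 0 ≤ (1 + 2 * ε) / ε := by positivity
          linarith

theorem gaussKernel_symm (c ε x : ℝ) : gaussKernel c ε (c + x) = gaussKernel c ε (c - x) := by
  unfold gaussKernel
  congr 3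
  ring

end GaussKernel

/-! ### From two-sided to one-sided derivatives -/

section ClassicalDerivatives

variable {U Ut Uz Uzz : ℝ → ℝ → ℝ} {I J : Set ℝ} {t z : ℝ}

theorem dt_eq (hI : UniqueDiffOn ℝ I) (ht : t ∈ I)
    (h : HasDerivAt (fun s => U s z) (Ut t z) t) : dt I U t z = Ut t z :=
  h.hasDerivWithinAt.derivWithin (hI t ht)

theorem dz_eq (hJ : UniqueDiffOn ℝ J) (hz : z ∈ J)
    (h : HasDerivAt (fun y => U t y) (Uz t z) z) : dz J U t z = Uz t z :=
  h.hasDerivWithinAt.derivWithin (hJ z hz)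

/-- `dz J U` is identified with `Uz` only on `J`; this suffices because the second derivative is
also taken within `J`. -/
theorem hasDerivWithinAt_dz (hJ : UniqueDiffOn ℝ J) (hz : z ∈ J)
    (h : ∀ y, HasDerivAt (fun y => U t y) (Uz t y) y)
    (h' : HasDerivAt (fun y => Uz t y) (Uzz t z) z) :
    HasDerivWithinAt (fun y => dz J U t y) (Uzz t z) J z :=
  h'.hasDerivWithinAt.congr_of_mem (fun y hy => dz_eq hJ hy (h y)) hz

theorem dzz_eq (hJ : UniqueDiffOn ℝ J) (hz : z ∈ J)
    (h : ∀ y, HasDerivAt (fun y => U t y) (Uz t y) y)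
    (h' : HasDerivAt (fun y => Uz t y) (Uzz t z) z) : dzz J U t z = Uzz t z :=
  (hasDerivWithinAt_dz hJ hz h h').derivWithin (hJ z hz)

theorem isC12On_of_hasDerivAt (hI : UniqueDiffOn ℝ I) (hJ : UniqueDiffOn ℝ J)
    (hU : Continuous fun p : ℝ × ℝ => U p.1 p.2) (hUt : Continuous fun p : ℝ × ℝ => Ut p.1 p.2)
    (hUz : Continuous fun p : ℝ × ℝ => Uz p.1 p.2)
    (hUzz : Continuous fun p : ℝ × ℝ => Uzz p.1 p.2)
    (ht : ∀ t z, HasDerivAt (fun s => U s z) (Ut t z) t)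
    (hz : ∀ t z, HasDerivAt (fun y => U t y) (Uz t z) z)
    (hzz : ∀ t z, HasDerivAt (fun y => Uz t y) (Uzz t z) z) : IsC12On I J U where
  continuousOn := hU.continuousOn
  differentiable_t t _ z _ := (ht t z).differentiableAt.differentiableWithinAt
  differentiable_z t _ z _ := (hz t z).differentiableAt.differentiableWithinAt
  differentiable_zz t _ _ hzJ :=
    (hasDerivWithinAt_dz hJ hzJ (hz t) (hzz t _)).differentiableWithinAt
  continuousOn_dt := hUt.continuousOn.congr fun p hp => dt_eq hI hp.1 (ht p.1 p.2)
  continuousOn_dz := hUz.continuousOn.congr fun p hp => dz_eq hJ hp.2 (hz p.1 p.2)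
  continuousOn_dzz := hUzz.continuousOn.congr fun p hp => dzz_eq hJ hp.2 (hz p.1) (hzz p.1 p.2)

end ClassicalDerivatives

/-! ### The Hamiltonian, the modification and the main theorem -/

theorem isLUB_range_mul_sub_sq {κ : ℝ} (hκ : 0 < κ) (a : ℝ) :
    IsLUB (Set.range fun v : ℝ => a * v - κ * v ^ 2) (a ^ 2 / (4 * κ)) := by
  -- Completing the square shows that `a / (2κ)` is the maximiser.
  refine IsGreatest.isLUB ⟨⟨a / (2 * κ), ?_⟩, ?_⟩
  · field_simp
    ring
  · rintro _ ⟨v, rfl⟩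
    have : a ^ 2 / (4 * κ) - (a * v - κ * v ^ 2) = κ * (v - a / (2 * κ)) ^ 2 := by
      field_simp
      ring
    have := mul_nonneg hκ.le (sq_nonneg (v - a / (2 * κ)))
    simp only
    linarith

/-- Discontinuous paths, a null set, are replaced by zero. Almost surely the two processes agree at
all times simultaneously, so path integrals agree as well. -/
theorem ProbabilityTheory.IsBrownianReal.exists_continuous_modification {Ω : Type*}
    [MeasurableSpace Ω] {P : Measure Ω} {W : ℝ≥0 → Ω → ℝ} (hW : IsBrownianReal W P) :
    ∃ X : ℝ≥0 → Ω → ℝ, IsPreBrownianReal X P ∧ (∀ ω, Continuous (X · ω)) ∧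
      ∀ᵐ ω ∂P, ∀ t, W t ω = X t ω := by
  classical
  have hae : ∀ᵐ ω ∂P, ∀ t, W t ω = if Continuous (W · ω) then W t ω else 0 := by
    filter_upwards [hW.cont] with ω hω t
    rw [if_pos hω]
  refine ⟨fun t ω => if Continuous (W · ω) then W t ω else 0,
    hW.toIsPreBrownianReal.congr fun t => ?_, fun ω => ?_, hae⟩
  · filter_upwards [hae] with ω hω using hω t
  · by_cases h : Continuous (W · ω)
    · simpa only [if_pos h] using h
    · simpa only [if_neg h] using continuous_const

theorem proposition1 {Ω : Type*} [MeasurableSpace Ω] (P : Measure Ω) [IsProbabilityMeasure P]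
    (W : ℝ≥0 → Ω → ℝ) (hW : IsBrownianReal W P)
    (σ γ κ c ε T β : ℝ) (hσ : 0 < σ) (hγ : 0 < γ) (hκ : 0 < κ) (hε : 0 < ε) (hT : 0 < T)
    (hβ : β = γ ^ 2 / (2 * κ * σ ^ 2)) :
    (∀ t ∈ Set.Ici (0 : ℝ), ∀ z : ℝ, Integrable (expFunctional W σ c ε β t z) P) ∧
    IsC12On (Set.Ici 0) Set.univ (approxValue P W σ c ε β) ∧
    IsClassicalHJBSolution σ γ κ c ε T (approxValue P W σ c ε β) := by
  have hβ0 : 0 < β := by rw [hβ]; positivity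
  obtain ⟨X, hX, hXc, hWX⟩ := hW.exists_continuous_modification
  obtain ⟨φ', φ'', M, h⟩ := exists_isBoundedC2_gaussKernel c β hε
  set φ : ℝ → ℝ := fun x => β * gaussKernel c ε x with hφ
  have hm := hX.aemeasurable
  have hexp : ∀ t z, expFunctional W σ c ε β t z
      =ᵐ[P] fun ω => Real.exp (pathIntegral X σ φ t z ω) := fun t z => by
    filter_upwards [hWX] with ω hω
    simp only [expFunctional, pathIntegral, hφ, hω, intervalIntegral.integral_const_mul]
  set V := feynmanKac P X σ φ with hV
  set Vt := feynmanKacTime P X σ φ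
  set Vz := feynmanKacSpace P X σ φ φ'
  set Vzz := feynmanKacSpace2 P X σ φ φ' φ''
  have hU : approxValue P W σ c ε β = fun t z => 1 / β * Real.log (V t z) := by
    funext t z
    rw [approxValue, integral_congr_ae (hexp t z)]
    rfl
  have hVpos : ∀ t z, 0 < V t z := feynmanKac_pos h hm hXc
  have hVc : Continuous fun p : ℝ × ℝ => V p.1 p.2 := continuous_feynmanKac h hm hXc
  have hVtc : Continuous fun p : ℝ × ℝ => Vt p.1 p.2 := continuous_feynmanKacTime h hm hXc
  have hVzc : Continuous fun p : ℝ × ℝ => Vz p.1 p.2 := continuous_feynmanKacSpace h hm hXc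
  have hVzzc : Continuous fun p : ℝ × ℝ => Vzz p.1 p.2 := continuous_feynmanKacSpace2 h hm hXc
  have hVne : ∀ p : ℝ × ℝ, V p.1 p.2 ≠ 0 := fun p => (hVpos p.1 p.2).ne'
  set Ut : ℝ → ℝ → ℝ := fun t z => 1 / β * (Vt t z / V t z) with hUt
  set Uz : ℝ → ℝ → ℝ := fun t z => 1 / β * (Vz t z / V t z) with hUz
  set Uzz : ℝ → ℝ → ℝ :=
    fun t z => 1 / β * ((Vzz t z * V t z - Vz t z * Vz t z) / V t z ^ 2) with hUzz
  have ht : ∀ t z, HasDerivAt (fun s => approxValue P W σ c ε β s z) (Ut t z) t := fun t z => by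
    rw [hU]
    exact ((hasDerivAt_feynmanKac_time h hm hXc t z).log (hVpos t z).ne').const_mul _
  have hz : ∀ t z, HasDerivAt (fun y => approxValue P W σ c ε β t y) (Uz t z) z := fun t z => by
    rw [hU]
    exact ((hasDerivAt_feynmanKac_space h hm hXc t z).log (hVpos t z).ne').const_mul _
  have hzz : ∀ t z, HasDerivAt (fun y => Uz t y) (Uzz t z) z := fun t z =>
    ((hasDerivAt_feynmanKacSpace h hm hXc t z).div (hasDerivAt_feynmanKac_space h hm hXc t z)
      (hVpos t z).ne').const_mul _
  have hC12 : ∀ {I J : Set ℝ}, UniqueDiffOn ℝ I → UniqueDiffOn ℝ J →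
      IsC12On I J (approxValue P W σ c ε β) := fun hI hJ => by
    refine isC12On_of_hasDerivAt (Ut := Ut) (Uz := Uz) (Uzz := Uzz) hI hJ ?_
      (continuous_const.mul (hVtc.div hVc hVne)) (continuous_const.mul (hVzc.div hVc hVne))
      (continuous_const.mul (((hVzzc.mul hVc).sub (hVzc.mul hVzc)).div (hVc.pow 2)
        fun p => pow_ne_zero 2 (hVne p))) ht hz hzz
    rw [hU]
    exact continuous_const.mul (hVc.log hVne)
  have hIcc : UniqueDiffOn ℝ (Set.Icc 0 T) := uniqueDiffOn_Icc hT
  have hIci : UniqueDiffOn ℝ (Set.Ici c) := uniqueDiffOn_Ici c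
  have hsup : ∀ p : ℝ, IsLUB (Set.range fun v : ℝ => γ * v * p - κ * v ^ 2)
      ((γ * p) ^ 2 / (4 * κ)) := fun p => by
    simpa only [mul_right_comm] using isLUB_range_mul_sub_sq hκ (γ * p)
  refine ⟨fun t _ z => (integrable_exp_pathIntegral h hm hXc t z).congr (hexp t z).symm,
    hC12 (uniqueDiffOn_Ici 0) uniqueDiffOn_univ, hC12 hIcc hIci,
    fun t _ z _ => (hsup _).bddAbove, fun t htI z hzJ => ?_, fun z _ => ?_, fun t _ => ?_⟩
  · have hzJ' : z ∈ Set.Ici c := Set.mem_Ici_of_Ioi hzJ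
    rw [(hsup _).ciSup_eq, dt_eq (Ut := Ut) hIcc (Set.Ioc_subset_Icc_self htI) (ht t z),
      dz_eq (Uz := Uz) hIci hzJ' (hz t z), dzz_eq (Uzz := Uzz) hIci hzJ' (hz t) (hzz t z)]
    have hpde : Vt t z = σ ^ 2 / 2 * Vzz t z + β * gaussKernel c ε z * V t z :=
      feynmanKacTime_eq h hX hXc htI.1.le z
    have hV0 := (hVpos t z).ne'
    -- The choice of `β`: it turns the supremum into `σ²/(2β) (Vz/V)²`, which cancels the quadratic
    -- term of `σ²/2 Uzz`.
    have hβ' : γ ^ 2 = 2 * κ * σ ^ 2 * β := by rw [hβ]; field_simp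
    simp only [hUt, hUz, hUzz, hpde, mul_pow, hβ']
    field_simp
    ring
  · rw [hU]
    simp [hV, feynmanKac, pathIntegral]
  · rw [dz_eq (Uz := Uz) hIci Set.self_mem_Ici (hz t c)]
    have : Vz t c = 0 := feynmanKacSpace_eq_zero h hX hXc
      (fun x => by simp only [hφ, gaussKernel_symm c ε x]) t
    simp [hUz, this]
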